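/- **Setting.** Let $\mathcal X$ be a nonempty set of contexts, $\mathcal A=[K]$ a finite set of actions, and let $\mathcal F$ be a class of functions $f:\mathcal X\times\mathcal A\times\mathcal A\to[0,1]$ with $f(x,a,a')+f(x,a',a)=1$ for all $x,a,a'$. Let $f^*\in\mathcal F$ have a Condorcet winner in every context: for every $x$ there is $a^*(x)\in\mathcal A$ with $f^*(x,a^*(x),a)\ge\frac12$ for all $a\in\mathcal A$. A query $(x,a,a')$ returns a label $y\in\{0,1\}$ which, given the past, is $\mathrm{Ber}(f^*(x,a,a'))$. The sub-optimality gap of a policy $\pi:\mathcal X\to\mathcal A$ is $$R(\pi)=\sup_{x\in\mathcal X} f^*(x,a^*(x),\pi(x))-\tfrac12 .$$ **Complexity measures.** $\mathcal N(\mathcal F,\alpha)$ is the least cardinality of a set $\mathcal G\subseteq\mathcal F$ such that every $f\in\mathcal F$ has some $g\in\mathcal G$ with $\|f-g\|_\infty\le\alpha$. Writing $\mathcal Z=\mathcal X\times\mathcal A\times\mathcal A$, the $\varepsilon$-eluder dimension $\dim_{\mathcal E}(\mathcal F,\varepsilon)$ is the length $n$ of the longest sequence $z_1,\dots,z_n\in\mathcal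 Z$ such that for some $\varepsilon'\ge\varepsilon$ and every $i\in\{2,\dots,n\}$ $$\sup_{f_1,f_2\in\mathcal F}\Big\{(f_1-f_2)(z_i)\ :\ \sqrt{\textstyle\sum_{j=1}^{i-1}(f_1-f_2)^2(z_j)}\le\varepsilon'\Big\}>\varepsilon' .$$ For $T$ rounds put $\mathcal N(\mathcal F)=\mathcal N(\mathcal F,1/T)$ and $d_{\mathcal E}(\mathcal F)=\dim_{\mathcal E}(\mathcal F,1/T)$; both are assumed finite. **Algorithm (APO-Gen with confidence level $\delta'$).** Put $\mathcal X_0=\mathcal X$ and $\mathcal A_0(x)=\mathcal A$ for all $x$. In round $t=1,\dots,T$: 1. compute a least-squares estimate $\widehat f_t\in\arg\min_{f\in\mathcal F}\sum_{s<t}(y_s-f(x_s,a_s,a_s'))^2$; 2. form $\mathcal C_t=\{f\in\mathcal F:\sum_{s<t}(f-\widehat f_t)^2(x_s,a_s,a'_s)\le\beta_t(\mathcal F,\delta')\}$, where $$\beta_t(\mathcal F,\delta')=2\log\frac{2\,\mathcal N(\mathcal F,1/t)}{\delta'}+2\sqrt{\log\frac{4t(t+1)}{\delta'}}+4,$$ and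 the bonus $b_t(x,a,a')=\sup_{f_1,f_2\in\mathcal C_t}|f_1(x,a,a')-f_2(x,a,a')|$; 3. for $x\in\mathcal X_{t-1}$ let $\mathcal A_t(x)=\{a\in\mathcal A_{t-1}(x): \widehat f_t(x,a,a_0)+b_t(x,a,a_0)\ge\frac12\ \ \forall a_0\in\mathcal A_{t-1}(x)\}$, and for $x\notin\mathcal X_{t-1}$ let $\mathcal A_t(x)=\mathcal A_{t-1}(x)$; let $\mathcal X_t=\{x\in\mathcal X_{t-1}:|\mathcal A_t(x)|\ne1\}$; 4. query $(x_t,a_t,a_t')\in\arg\max\{b_t(x,a,a'):x\in\mathcal X_t,\ a,a'\in\mathcal A_t(x)\}$ (an arbitrary triple if there is no candidate) and observe $y_t$. Ties in the minimization and in the maximization are broken arbitrarily as a function of the past (both are assumed to be attained). The output is any policy $\pi_T$ with $\pi_T(x)\in\mathcal A_T(x)$ for all $x$. **Theorem.** There is an absolute constant $C>0$ such that for all $\mathcal X,K,\mathcal F,f^*,a^*$ as above, all $T\ge2$ and all $\delta\in(0,1)$, if APO-Gen is run for $T$ rounds with confidence level $\delta'=\delta/T$, then with probability at least $1-\delta$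 all sets $\mathcal A_T(x)$ are nonempty and every policy $\pi_T$ with $\pi_T(x)\in\mathcal A_T(x)$ for all $x$ satisfies $$R(\pi_T)\ \le\ C\,\sqrt{\frac{\log\!\big(\mathcal N(\mathcal F)\,T/\delta\big)\; d_{\mathcal E}(\mathcal F)}{T}} .$$ -/

import Mathlib

namespace APOGen

/-- `G` is a finite subset of `F` such that every `f ∈ F` is within `α` of some element of `G`
in the supremum norm. -/
def IsCover {Z : Type*} (F : Set (Z → unitInterval)) (α : ℝ) (G : Finset (Z → unitInterval)) :
    Prop :=
  (∀ g ∈ G, g ∈ F) ∧ ∀ f ∈ F, ∃ g ∈ G, ∀ z, |(f z : ℝ) - (g z : ℝ)| ≤ α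

/-- The sup-norm covering number of `F` at scale `α` (`⊤` if there is no finite cover). -/
noncomputable def coveringNumber {Z : Type*} (F : Set (Z → unitInterval)) (α : ℝ) : ℕ∞ :=
  ⨅ (G : Finset (Z → unitInterval)) (_ : IsCover F α G), (G.card : ℕ∞)

/-- The sequence `z` witnesses that the `ε`-eluder dimension of `F` is at least `n`: for a single
`ε' ≥ ε`, every point after the first is `ε'`-independent of the points before it. The supremum of
the differences `(f₁ - f₂) (z i)` over the admissible pairs exceeds `ε'` exactly when one of these
differences does. -/
def IsEluderSeq {Z : Type*} (F : Set (Z → unitInterval)) (ε : ℝ) {n : ℕ} (z : Fin n → Z) : Prop :=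
  ∃ ε' : ℝ, ε ≤ ε' ∧ ∀ i : Fin n, 1 ≤ (i : ℕ) →
    ∃ f₁ ∈ F, ∃ f₂ ∈ F,
      Real.sqrt (∑ j ∈ Finset.Iio i, ((f₁ (z j) : ℝ) - (f₂ (z j) : ℝ)) ^ 2) ≤ ε' ∧
        ε' < (f₁ (z i) : ℝ) - (f₂ (z i) : ℝ)

/-- The `ε`-eluder dimension of `F`: the length of the longest eluder sequence (`⊤` if there are
arbitrarily long ones). -/
noncomputable def eluderDim {Z : Type*} (F : Set (Z → unitInterval)) (ε : ℝ) : ℕ∞ :=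
  ⨆ (n : ℕ) (_ : ∃ z : Fin n → Z, IsEluderSeq F ε z), (n : ℕ∞)

/-- A context together with an ordered pair of actions out of `K`. -/
abbrev Query (X : Type*) (K : ℕ) : Type _ := X × Fin K × Fin K

/-- A preference function; `f (x, a, a')` is the probability that `a` wins over `a'` in the
context `x`. -/
abbrev Pref (X : Type*) (K : ℕ) : Type _ := Query X K → unitInterval

/-- The observed preference as a real number. -/
def label (y : Bool) : ℝ := if y then 1 else 0

/-- The Bernoulli distribution on `Bool` that gives mass `p` to `true`. -/
noncomputable def coin (p : unitInterval) : PMF Bool :=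
  PMF.ofFintype (fun y => ENNReal.ofReal (if y then (p : ℝ) else 1 - (p : ℝ))) <| by
    have h := p.2
    simp only [Fintype.sum_bool, if_true, Bool.false_eq_true, if_false]
    rw [← ENNReal.ofReal_add h.1 (by linarith [h.2])]
    simp

/-!
In what follows a list of labels is a history, with the newest label first: in round `t` the
history is `h = [y_{t-1}, …, y_1]`, so that `t = h.length + 1`. A learner is given by the query
`query h` made and the estimate `est h` computed in the round with history `h`.
-/

section Algorithm

variable {X : Type*} {K : ℕ}

/-- The law of the labels of the first `n` rounds: in each round the label is Bernoulli with the
parameter that the true preference function `fstar` assigns to the query of that round. -/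
noncomputable def interaction (fstar : Pref X K) (query : List Bool → Query X K) :
    ℕ → PMF (List Bool)
  | 0 => PMF.pure []
  | n + 1 => (interaction fstar query n).bind fun h =>
      (coin (fstar (query h))).map fun y => y :: h

/-- Cumulative squared prediction error of `f` on the past data. -/
def loss (query : List Bool → Query X K) (f : Pref X K) : List Bool → ℝ
  | [] => 0
  | y :: h => loss query f h + (label y - (f (query h) : ℝ)) ^ 2

/-- Sum of the squared differences of `f` and `g` at the past queries. -/
def sqDist (query : List Bool → Query X K) (f g : Pref X K) : List Bool → ℝ
  | [] => 0
  | _ :: h => sqDist query f g h + ((f (query h) : ℝ) - (g (query h) : ℝ)) ^ 2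

/-- The confidence parameter of round `t` at confidence level `δ`; the covering number is taken at
scale `1 / t`. -/
noncomputable def confRadius (F : Set (Pref X K)) (δ : ℝ) (t : ℕ) : ℝ :=
  2 * Real.log (2 * ((coveringNumber F (1 / (t : ℝ))).toNat : ℝ) / δ)
    + 2 * Real.sqrt (Real.log (4 * (t : ℝ) * ((t : ℝ) + 1) / δ)) + 4

/-- The confidence set of the round with history `h`. -/
def confSet (F : Set (Pref X K)) (δ : ℝ) (est : List Bool → Pref X K)
    (query : List Bool → Query X K) (h : List Bool) : Set (Pref X K) :=
  {f ∈ F | sqDist query f (est h) h ≤ confRadius F δ (h.length + 1)}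

/-- The exploration bonus of `q` in the round with history `h`. -/
noncomputable def bonus (F : Set (Pref X K)) (δ : ℝ) (est : List Bool → Pref X K)
    (query : List Bool → Query X K) (h : List Bool) (q : Query X K) : ℝ :=
  sSup {r : ℝ | ∃ f₁ ∈ confSet F δ est query h, ∃ f₂ ∈ confSet F δ est query h,
    r = |(f₁ q : ℝ) - (f₂ q : ℝ)|}

/-- What the learner maintains: the set of contexts still under consideration and, for every
context, the set of near-optimal actions. -/
structure State (X : Type*) (K : ℕ) where
  contexts : Set X
  actions : X → Set (Fin K)

/-- Action elimination for the contexts under consideration; the action sets of the other contexts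
are frozen. -/
def eliminate (F : Set (Pref X K)) (δ : ℝ) (est : List Bool → Pref X K)
    (query : List Bool → Query X K) (h : List Bool) (S : State X K) (x : X) : Set (Fin K) :=
  {a ∈ S.actions x | x ∈ S.contexts →
    ∀ a₀ ∈ S.actions x, 1 / 2 ≤ (est h (x, a, a₀) : ℝ) + bonus F δ est query h (x, a, a₀)}

/-- The update of one round: eliminate actions, then drop the contexts that are left with exactly
one action. -/
def step (F : Set (Pref X K)) (δ : ℝ) (est : List Bool → Pref X K)
    (query : List Bool → Query X K) (h : List Bool) (S : State X K) : State X K where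
  contexts := {x ∈ S.contexts | (eliminate F δ est query h S x).ncard ≠ 1}
  actions := eliminate F δ est query h S

/-- The state after the update of the round with history `h`, that is, of round `h.length + 1`;
before the first round all contexts and all actions are present. -/
def state (F : Set (Pref X K)) (δ : ℝ) (est : List Bool → Pref X K)
    (query : List Bool → Query X K) : List Bool → State X K
  | [] => step F δ est query [] ⟨Set.univ, fun _ => Set.univ⟩
  | y :: h => step F δ est query (y :: h) (state F δ est query h)

/-- The queries among which the learner chooses in the round with history `h`. -/
def candidates (F : Set (Pref X K)) (δ : ℝ) (est : List Bool → Pref X K)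
    (query : List Bool → Query X K) (h : List Bool) : Set (Query X K) :=
  {q | q.1 ∈ (state F δ est query h).contexts ∧
    q.2.1 ∈ (state F δ est query h).actions q.1 ∧ q.2.2 ∈ (state F δ est query h).actions q.1}

/-- `est` and `query` are the estimates and the queries of a `T`-round execution of the algorithm
with confidence level `δ`: in every round the estimate is a least-squares minimizer over `F` and
the query maximizes the bonus over the candidates, ties being broken arbitrarily. If no candidate
is left, the query is arbitrary. -/
structure IsExecution (F : Set (Pref X K)) (δ : ℝ) (T : ℕ) (est : List Bool → Pref X K)
    (query : List Bool → Query X K) : Prop where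
  est_mem : ∀ h : List Bool, h.length < T → est h ∈ F
  est_le : ∀ h : List Bool, h.length < T → ∀ f ∈ F, loss query (est h) h ≤ loss query f h
  query_mem : ∀ h : List Bool, h.length < T → (candidates F δ est query h).Nonempty →
    query h ∈ candidates F δ est query h
  query_max : ∀ h : List Bool, h.length < T → ∀ q ∈ candidates F δ est query h,
    bonus F δ est query h q ≤ bonus F δ est query h (query h)

/-- The near-optimal actions for `x` when the algorithm ends with the labels `ys = [y_T, …, y_1]`.
The sets of round `T` are computed before `y_T` is observed, from the history `ys.tail`. -/
def finalActions (F : Set (Pref X K)) (δ : ℝ) (est : List Bool → Pref X K)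
    (query : List Bool → Query X K) (ys : List Bool) (x : X) : Set (Fin K) :=
  (state F δ est query ys.tail).actions x

/-- The sub-optimality gap of the policy `pol` against the Condorcet winners `astar`. -/
noncomputable def subOptGap (fstar : Pref X K) (astar pol : X → Fin K) : ℝ :=
  ⨆ x, ((fstar (x, astar x, pol x) : ℝ) - 1 / 2)

end Algorithm

end APOGen

/-! A confidence-set bound is combined with a pigeonhole argument for the eluder dimension. For a
fixed `g` the exponential of `excess` is a supermartingale. Markov's inequality and a union bound
over a minimal cover then show that, in any single round, `fstar` lies in the confidence set outside
an event of probability `δ / T` (`toOuterMeasure_notMem_confSet_le`); the union over `T` rounds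
costs `δ`.

On the good event the winner is never eliminated, so a dropped context retains only its winner and
has gap zero. If an action with gap `g` survives in a context still active at the end, its
comparison with the winner was a candidate in every round. The elimination test and the maximality
of the query then force every queried bonus to be at least `g / 2` (`sub_half_le_bonus_query`).

Bonuses cannot all exceed `ε = g / 4` for long. Two members of a confidence set of radius at most
`β` have squared distance at most `4 * β` on the past, so the queries split into about `4 * β / ε ^
2` eluder sequences, whence `T ≤ (4 * β / ε ^ 2 + 1) * d` once `ε ≥ 1 / T`
(`le_mul_eluderDim_of_lt_bonus`). Since `β` is of order `log (N * T / δ)`, solving for `g` gives the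
rate. -/

namespace APOGen

/-! ### Eluder sequences and the pigeonhole bound. -/

section Eluder

variable {Z : Type*} {F : Set (Z → unitInterval)}

theorem le_eluderDim {ε : ℝ} {n : ℕ} {z : Fin n → Z} (h : IsEluderSeq F ε z) :
    (n : ℕ∞) ≤ eluderDim F ε :=
  le_iSup₂_of_le n ⟨z, h⟩ le_rfl

theorem one_le_eluderDim [Nonempty Z] (ε : ℝ) : 1 ≤ eluderDim F ε := by
  obtain ⟨z⟩ := ‹Nonempty Z›
  have h : IsEluderSeq F ε (fun _ : Fin 1 => z) := ⟨ε, le_rfl, fun i hi => by omega⟩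
  exact_mod_cast le_eluderDim h

/-- Points can be distributed greedily into `k` classes such that every point is independent of its
predecessors in its class, if the differences of functions separating it from the past have total
squared size at most `k * ε ^ 2`. -/
theorem exists_independent_coloring {ε : ℝ} (z : ℕ → Z) {k : ℕ} (hk : 0 < k) (S : Finset ℕ)
    (H : ∀ i ∈ S, ∃ f₁ ∈ F, ∃ f₂ ∈ F,
      ∑ j ∈ S with j < i, ((f₁ (z j) : ℝ) - (f₂ (z j) : ℝ)) ^ 2 ≤ k * ε ^ 2 ∧
        ε < (f₁ (z i) : ℝ) - (f₂ (z i) : ℝ)) :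
    ∃ c : ℕ → Fin k, ∀ i ∈ S, ∃ f₁ ∈ F, ∃ f₂ ∈ F,
      ∑ j ∈ S with j < i ∧ c j = c i, ((f₁ (z j) : ℝ) - (f₂ (z j) : ℝ)) ^ 2 ≤ ε ^ 2 ∧
        ε < (f₁ (z i) : ℝ) - (f₂ (z i) : ℝ) := by
  induction S using Finset.induction_on_max with
  | empty => exact ⟨fun _ => ⟨0, hk⟩, by simp⟩
  | insert a S ha ih =>
    have haS : a ∉ S := fun h => lt_irrefl a (ha a h)
    obtain ⟨c, hc⟩ := ih fun i hi => by
      have := H i (Finset.mem_insert_of_mem hi)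
      rwa [Finset.filter_insert, if_neg (ha i hi).not_gt] at this
    obtain ⟨f₁, hf₁, f₂, hf₂, hsum, hlt⟩ := H a (Finset.mem_insert_self a S)
    rw [Finset.filter_insert, if_neg (lt_irrefl a), Finset.filter_true_of_mem ha] at hsum
    -- Pigeonhole: if the sum over each of the `k` classes exceeded `ε ^ 2`, the total would exceed
    -- `k * ε ^ 2`. The largest point `a` joins a class where this fails, which leaves the
    -- conditions at earlier points untouched.
    obtain ⟨j, hj⟩ : ∃ j : Fin k,
        ∑ s ∈ S with c s = j, ((f₁ (z s) : ℝ) - (f₂ (z s) : ℝ)) ^ 2 ≤ ε ^ 2 := by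
      by_contra! hcon
      have : Nonempty (Fin k) := ⟨⟨0, hk⟩⟩
      have h1 := Finset.sum_lt_sum_of_nonempty (s := (Finset.univ : Finset (Fin k)))
        Finset.univ_nonempty (fun j _ => hcon j)
      rw [Finset.sum_fiberwise] at h1
      simp at h1
      linarith
    have hupd : ∀ s ∈ S, Function.update c a j s = c s := fun s hs =>
      Function.update_of_ne (fun h : s = a => haS (h ▸ hs)) _ _
    refine ⟨Function.update c a j, fun i hi => ?_⟩
    rcases Finset.mem_insert.1 hi with rfl | hi
    · refine ⟨f₁, hf₁, f₂, hf₂, ?_, hlt⟩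
      rw [Finset.filter_insert, if_neg (fun h => lt_irrefl i h.1)]
      convert hj using 2
      refine Finset.filter_congr fun s hs => ?_
      simp [hupd s hs, ha s hs]
    · obtain ⟨g₁, hg₁, g₂, hg₂, hs, hl⟩ := hc i hi
      refine ⟨g₁, hg₁, g₂, hg₂, ?_, hl⟩
      rw [Finset.filter_insert, if_neg (fun h => (ha i hi).not_gt h.1)]
      convert hs using 2
      refine Finset.filter_congr fun s hs => ?_
      rw [hupd s hs, hupd i hi]

/-- Each colour class, listed in increasing order, is an eluder sequence at the common scale `ε'`,
so its size is at most the eluder dimension. -/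
theorem card_le_mul_eluderDim {ε ε' : ℝ} (hε : 0 ≤ ε') (hεε' : ε ≤ ε') (z : ℕ → Z) {k : ℕ}
    (hk : 0 < k) (S : Finset ℕ) (hd : eluderDim F ε ≠ ⊤)
    (H : ∀ i ∈ S, ∃ f₁ ∈ F, ∃ f₂ ∈ F,
      ∑ j ∈ S with j < i, ((f₁ (z j) : ℝ) - (f₂ (z j) : ℝ)) ^ 2 ≤ k * ε' ^ 2 ∧
        ε' < (f₁ (z i) : ℝ) - (f₂ (z i) : ℝ)) :
    S.card ≤ k * (eluderDim F ε).toNat := by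
  obtain ⟨c, hc⟩ := exists_independent_coloring z hk S H
  have hcls : ∀ j ∈ (Finset.univ : Finset (Fin k)),
      (S.filter (fun s => c s = j)).card ≤ (eluderDim F ε).toNat := by
    intro j _
    set B := S.filter (fun s => c s = j) with hB
    let e := B.orderEmbOfFin rfl
    have hmem : ∀ i, e i ∈ S ∧ c (e i) = j := fun i => by
      exact Finset.mem_filter.1 (B.orderEmbOfFin_mem rfl i)
    have hseq : IsEluderSeq F ε (fun i : Fin B.card => z (e i)) := by
      refine ⟨ε', hεε', fun i _ => ?_⟩
      obtain ⟨f₁, hf₁, f₂, hf₂, hs, hl⟩ := hc (e i) (hmem i).1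
      refine ⟨f₁, hf₁, f₂, hf₂, ?_, hl⟩
      rw [Real.sqrt_le_left hε]
      refine le_trans ?_ hs
      refine (Finset.sum_map (Finset.Iio i) e.toEmbedding
        (fun s => ((f₁ (z s) : ℝ) - (f₂ (z s) : ℝ)) ^ 2)).symm.trans_le ?_
      refine Finset.sum_le_sum_of_subset_of_nonneg ?_ fun _ _ _ => sq_nonneg _
      intro s hs
      obtain ⟨l, hl, rfl⟩ := Finset.mem_map.1 hs
      have hl : l < i := by simpa using hl
      simp [(hmem l).1, (hmem l).2, (hmem i).2, hl]
    have := ENat.toNat_le_toNat (le_eluderDim hseq) hd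
    simpa using this
  have := Finset.card_le_mul_card_image_of_maps_to (s := S) (t := Finset.univ) (f := c)
    (fun _ _ => Finset.mem_univ _) _ hcls
  simpa [mul_comm] using this

end Eluder

/-! ### Covering numbers. -/

section Covering

variable {Z : Type*} {F : Set (Z → unitInterval)}

theorem coveringNumber_antitone : Antitone (coveringNumber F) := fun _ _ h =>
  le_iInf₂ fun G hG => iInf₂_le_of_le G
    ⟨hG.1, fun f hf => (hG.2 f hf).imp fun _ hg => ⟨hg.1, fun z => (hg.2 z).trans h⟩⟩ le_rfl

theorem exists_isCover_card_eq {α : ℝ} (h : coveringNumber F α ≠ ⊤) :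
    ∃ G, IsCover F α G ∧ G.card = (coveringNumber F α).toNat := by
  have h' : coveringNumber F α =
      ⨅ G : {G : Finset (Z → unitInterval) // IsCover F α G}, (G.1.card : ℕ∞) := by
    rw [coveringNumber, iInf_subtype']
  have : Nonempty {G : Finset (Z → unitInterval) // IsCover F α G} := by
    by_contra hne
    rw [not_nonempty_iff] at hne
    exact h (by rw [h', iInf_of_empty])
  obtain ⟨G, hG⟩ := ENat.exists_eq_iInf
    (fun G : {G : Finset (Z → unitInterval) // IsCover F α G} => (G.1.card : ℕ∞))
  refine ⟨G, G.2, ?_⟩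
  rw [h', ← hG, ENat.toNat_natCast]

theorem one_le_toNat_coveringNumber (hF : F.Nonempty) {α : ℝ} (h : coveringNumber F α ≠ ⊤) :
    1 ≤ (coveringNumber F α).toNat := by
  obtain ⟨G, hG, hc⟩ := exists_isCover_card_eq h
  obtain ⟨f, hf⟩ := hF
  obtain ⟨g, hg, _⟩ := hG.2 f hf
  rw [← hc]
  exact Finset.card_pos.2 ⟨g, hg⟩

end Covering
end APOGen

/-! ### Concentration for the interaction with the environment. -/

namespace APOGen

open scoped ENNReal

theorem coin_true (p : unitInterval) : coin p true = ENNReal.ofReal p := by simp [coin]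

theorem coin_false (p : unitInterval) : coin p false = ENNReal.ofReal (1 - p) := by simp [coin]

/-- Hoeffding's lemma for a Bernoulli variable. -/
theorem bernoulli_exp_le (p : unitInterval) (t : ℝ) :
    (p : ℝ) * Real.exp (t * (1 - p)) + (1 - (p : ℝ)) * Real.exp (-(t * p)) ≤
      Real.exp (t ^ 2 / 8) := by
  have hX : ∀ᵐ y ∂(coin p).toMeasure, label y ∈ Set.Icc (0 : ℝ) 1 :=
    .of_forall fun y => by cases y <;> simp [label]
  have hint : ∫ y, label y ∂(coin p).toMeasure = p := by
    rw [PMF.integral_eq_sum]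
    simp [label, coin_true, p.2.1]
  have h := (ProbabilityTheory.hasSubgaussianMGF_of_mem_Icc
    (measurable_of_finite label).aemeasurable hX).mgf_le t
  rw [hint, ProbabilityTheory.mgf, PMF.integral_eq_sum] at h
  have h1 : (0 : ℝ) ≤ 1 - p := sub_nonneg.2 p.2.2
  simp only [Fintype.sum_bool, coin_true, coin_false, label, ENNReal.toReal_ofReal p.2.1,
    ENNReal.toReal_ofReal h1, smul_eq_mul, if_true, Bool.false_eq_true, if_false, zero_sub,
    mul_neg] at h
  refine h.trans (Real.exp_le_exp.2 (le_of_eq ?_))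
  norm_num
  ring

section Interaction

variable {X : Type*} {K : ℕ} (fstar : Pref X K) (query : List Bool → Query X K)

theorem length_of_mem_support_interaction {n : ℕ} {ys : List Bool}
    (h : ys ∈ (interaction fstar query n).support) : ys.length = n := by
  induction n generalizing ys with
  | zero => simp [interaction] at h; simp [h]
  | succ n ih =>
    rw [interaction, PMF.mem_support_bind_iff] at h
    obtain ⟨h', hh', hy⟩ := h
    rw [PMF.mem_support_map_iff] at hy
    obtain ⟨y, -, rfl⟩ := hy
    simp [ih hh']

/-- Forgetting the newest label recovers the law of the earlier rounds. This serves the union bound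
and also the output, which ignores the last label. -/
theorem toOuterMeasure_interaction_succ_tail (n : ℕ) (S : Set (List Bool)) :
    (interaction fstar query (n + 1)).toOuterMeasure {ys | ys.tail ∈ S} =
      (interaction fstar query n).toOuterMeasure S := by
  rw [interaction, PMF.toOuterMeasure_bind_apply, PMF.toOuterMeasure_apply]
  refine tsum_congr fun h => ?_
  rw [PMF.toOuterMeasure_map_apply]
  by_cases hS : h ∈ S
  · have : (fun y => y :: h) ⁻¹' {ys : List Bool | ys.tail ∈ S} = Set.univ := by
      ext y; simp [hS]
    rw [this, Set.indicator_of_mem hS,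
      (PMF.toOuterMeasure_apply_eq_one_iff _ _).2 (Set.subset_univ _), mul_one]
  · have : (fun y => y :: h) ⁻¹' {ys : List Bool | ys.tail ∈ S} = ∅ := by
      ext y; simp [hS]
    rw [this, Set.indicator_of_notMem hS, MeasureTheory.measure_empty, mul_zero]

/-- Union bound over all rounds. -/
theorem toOuterMeasure_exists_suffix_le {P : List Bool → Prop} {c : ℝ≥0∞} {T : ℕ}
    (hP : ∀ n < T, (interaction fstar query n).toOuterMeasure {h | ¬ P h} ≤ c) :
    ∀ n < T, (interaction fstar query n).toOuterMeasure {h | ¬ ∀ h', h' <:+ h → P h'} ≤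
      (n + 1 : ℕ) * c := by
  intro n hn
  induction n with
  | zero =>
    refine le_trans (PMF.toOuterMeasure_mono _ ?_) ((hP 0 hn).trans (by simp))
    rintro h ⟨hh, hs⟩
    have : h = [] := by simpa [interaction] using hs
    subst this
    simpa using hh
  | succ n ih =>
    -- A failure occurs either at the current history or at a suffix of its tail.
    have hsub : {h : List Bool | ¬ ∀ h', h' <:+ h → P h'} ⊆
        {h | ¬ P h} ∪ {h | h.tail ∈ {h : List Bool | ¬ ∀ h', h' <:+ h → P h'}} := by
      intro h hh
      by_contra hcon
      simp only [Set.mem_union, Set.mem_ofPred_eq, not_or, not_not] at hcon hh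
      refine hh fun h' hs => ?_
      cases h with
      | nil => exact hcon.2 h' hs
      | cons y h =>
        rcases List.suffix_cons_iff.1 hs with rfl | hs
        · exact hcon.1
        · exact hcon.2 h' hs
    refine (MeasureTheory.measure_mono hsub).trans ((MeasureTheory.measure_union_le _ _).trans ?_)
    rw [toOuterMeasure_interaction_succ_tail]
    refine (add_le_add (hP _ hn) (ih (by omega))).trans (le_of_eq ?_)
    push_cast
    ring

/-- The tower property: condition on the first `n` labels and average over the next one. -/
theorem tsum_interaction_succ_mul (n : ℕ) (W : List Bool → ℝ≥0∞) :
    ∑' ys, interaction fstar query (n + 1) ys * W ys =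
      ∑' h, interaction fstar query n h *
        (coin (fstar (query h)) true * W (true :: h) +
          coin (fstar (query h)) false * W (false :: h)) := by
  simp only [interaction, PMF.bind_apply, ← ENNReal.tsum_mul_right]
  rw [ENNReal.tsum_comm]
  refine tsum_congr fun h => ?_
  simp only [mul_assoc, ENNReal.tsum_mul_left]
  congr 1
  simp only [PMF.map_apply, ← ENNReal.tsum_mul_right]
  rw [ENNReal.tsum_comm, tsum_fintype, Fintype.sum_bool]
  congr 1 <;>
  · rw [tsum_eq_single, if_pos rfl]
    intro b hb
    rw [if_neg hb, zero_mul]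

/-- The exponent of the supermartingale comparing `g` to the truth. -/
noncomputable def excess (g : Pref X K) (h : List Bool) : ℝ :=
  loss query fstar h - loss query g h + sqDist query g fstar h / 2

theorem excess_cons (g : Pref X K) (y : Bool) (h : List Bool) :
    excess fstar query g (y :: h) = excess fstar query g h +
      (2 * (label y - fstar (query h)) * ((g (query h) : ℝ) - fstar (query h)) -
        ((g (query h) : ℝ) - fstar (query h)) ^ 2 / 2) := by
  simp only [excess, loss, sqDist]
  ring

/-- With `d = g - p` at the query, the increment of `excess` is `2 * (y - p) * d - d ^ 2 / 2`.
Hoeffding's lemma bounds the first term's exponential moment by `exp (d ^ 2 / 2)`, which cancels the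
second exactly; this dictates the factor `1 / 2` in `excess`. -/
theorem coin_mul_exp_excess_le (g : Pref X K) (h : List Bool) :
    coin (fstar (query h)) true * ENNReal.ofReal (Real.exp (excess fstar query g (true :: h))) +
      coin (fstar (query h)) false * ENNReal.ofReal (Real.exp (excess fstar query g (false :: h)))
      ≤ ENNReal.ofReal (Real.exp (excess fstar query g h)) := by
  set p := fstar (query h)
  have h0 : (0 : ℝ) ≤ p := p.2.1
  have h1 : (0 : ℝ) ≤ 1 - p := sub_nonneg.2 p.2.2
  rw [coin_true, coin_false, ← ENNReal.ofReal_mul h0, ← ENNReal.ofReal_mul h1,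
    ← ENNReal.ofReal_add (by positivity) (by positivity)]
  refine ENNReal.ofReal_le_ofReal ?_
  rw [excess_cons, excess_cons, Real.exp_add, Real.exp_add]
  set d : ℝ := (g (query h) : ℝ) - p with hd
  have hB := bernoulli_exp_le p (2 * d)
  have e1 : Real.exp (2 * (label true - p) * d - d ^ 2 / 2) =
      Real.exp (2 * d * (1 - p)) * Real.exp (-(d ^ 2 / 2)) := by
    rw [← Real.exp_add]; simp only [label, if_true]; ring_nf
  have e2 : Real.exp (2 * (label false - p) * d - d ^ 2 / 2) =
      Real.exp (-(2 * d * p)) * Real.exp (-(d ^ 2 / 2)) := by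
    rw [← Real.exp_add]; simp only [label, Bool.false_eq_true, if_false]; ring_nf
  have e3 : Real.exp ((2 * d) ^ 2 / 8) * Real.exp (-(d ^ 2 / 2)) = 1 := by
    rw [← Real.exp_add, ← Real.exp_zero]; ring_nf
  change (p : ℝ) * (_ * Real.exp (2 * (label true - p) * d - d ^ 2 / 2)) +
    (1 - (p : ℝ)) * (_ * Real.exp (2 * (label false - p) * d - d ^ 2 / 2)) ≤ _
  rw [e1, e2]
  calc _ = Real.exp (excess fstar query g h) * ((p * Real.exp (2 * d * (1 - p)) +
        (1 - p) * Real.exp (-(2 * d * p))) * Real.exp (-(d ^ 2 / 2))) := by ring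
    _ ≤ Real.exp (excess fstar query g h) *
        (Real.exp ((2 * d) ^ 2 / 8) * Real.exp (-(d ^ 2 / 2))) := by gcongr
    _ = _ := by rw [e3, mul_one]

theorem tsum_interaction_mul_exp_excess_le (g : Pref X K) (n : ℕ) :
    ∑' ys, interaction fstar query n ys * ENNReal.ofReal (Real.exp (excess fstar query g ys)) ≤
      1 := by
  induction n with
  | zero =>
    rw [tsum_eq_single []]
    · simp [interaction, excess, loss, sqDist]
    · intro b hb
      simp [interaction, hb]
  | succ n ih =>
    rw [tsum_interaction_succ_mul]
    refine le_trans (ENNReal.tsum_le_tsum fun h => ?_) ih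
    gcongr
    exact coin_mul_exp_excess_le fstar query g h

/-- Markov's inequality for the exponential supermartingale. -/
theorem toOuterMeasure_lt_excess_le (g : Pref X K) (n : ℕ) {c : ℝ} (hc : 0 < c) :
    (interaction fstar query n).toOuterMeasure {h | Real.log c⁻¹ < excess fstar query g h} ≤
      ENNReal.ofReal c := by
  rw [PMF.toOuterMeasure_apply]
  calc _ ≤ ∑' h, interaction fstar query n h *
        ENNReal.ofReal (Real.exp (excess fstar query g h)) * ENNReal.ofReal c := by
        refine ENNReal.tsum_le_tsum fun h =>
          Set.indicator_apply_le' (fun hh => ?_) (fun _ => zero_le)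
        rw [mul_assoc, ← ENNReal.ofReal_mul (Real.exp_pos _).le]
        refine le_mul_of_one_le_right' (ENNReal.one_le_ofReal.2 ?_)
        have := (Real.log_lt_iff_lt_exp (inv_pos.2 hc)).1 hh
        calc (1 : ℝ) = c⁻¹ * c := (inv_mul_cancel₀ hc.ne').symm
          _ ≤ _ := by gcongr
    _ ≤ 1 * ENNReal.ofReal c := by
        rw [ENNReal.tsum_mul_right]
        gcongr
        exact tsum_interaction_mul_exp_excess_le fstar query g n
    _ = _ := one_mul _

theorem toOuterMeasure_exists_lt_excess_le (G : Finset (Pref X K)) (n : ℕ) {δ : ℝ} (hδ : 0 < δ) :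
    (interaction fstar query n).toOuterMeasure
      {h | ∃ g ∈ G, Real.log (G.card / δ) < excess fstar query g h} ≤ ENNReal.ofReal δ := by
  rcases G.eq_empty_or_nonempty with rfl | hG
  · simp
  have hN : (0 : ℝ) < G.card := by exact_mod_cast hG.card_pos
  have hset : {h | ∃ g ∈ G, Real.log (G.card / δ) < excess fstar query g h} =
      ⋃ g ∈ G, {h | Real.log (δ / G.card)⁻¹ < excess fstar query g h} := by
    ext h; simp
  rw [hset]
  refine (MeasureTheory.measure_biUnion_finset_le _ _).trans ?_
  refine (Finset.sum_le_sum fun g _ =>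
    toOuterMeasure_lt_excess_le fstar query g n (div_pos hδ hN)).trans (le_of_eq ?_)
  rw [Finset.sum_const, nsmul_eq_mul, ← ENNReal.ofReal_natCast, ← ENNReal.ofReal_mul hN.le]
  congr 1
  field_simp

end Interaction
end APOGen

namespace APOGen

/-! ### Confidence sets and bonuses. -/

section Confidence

variable {X : Type*} {K : ℕ} {F : Set (Pref X K)} {δ : ℝ} {est : List Bool → Pref X K}
  {query : List Bool → Query X K}

theorem sqDist_nonneg (f g : Pref X K) (h : List Bool) : 0 ≤ sqDist query f g h := by
  induction h with
  | nil => exact le_rfl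
  | cons y h ih => exact add_nonneg ih (sq_nonneg _)

theorem sqDist_self (f : Pref X K) (h : List Bool) : sqDist query f f h = 0 := by
  induction h with
  | nil => rfl
  | cons y h ih => simp [sqDist, ih]

theorem sqDist_comm (f g : Pref X K) (h : List Bool) :
    sqDist query f g h = sqDist query g f h := by
  induction h with
  | nil => rfl
  | cons y h ih => simp only [sqDist, ih]; ring

theorem sqDist_le_two_mul_add (f₁ f₂ g : Pref X K) (h : List Bool) :
    sqDist query f₁ f₂ h ≤ 2 * (sqDist query f₁ g h + sqDist query f₂ g h) := by
  induction h with
  | nil => simp [sqDist]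
  | cons y h ih =>
    simp only [sqDist]
    nlinarith [sq_nonneg ((f₁ (query h) : ℝ) - g (query h) + ((f₂ (query h) : ℝ) - g (query h)))]

theorem mul_le_two_mul_of_abs_le {a b α : ℝ} (ha : |a| ≤ α) (hb : |b| ≤ 2) : a * b ≤ 2 * α := by
  calc a * b ≤ |a * b| := le_abs_self _
    _ = |a| * |b| := abs_mul a b
    _ ≤ α * 2 := mul_le_mul ha hb (abs_nonneg _) ((abs_nonneg _).trans ha)
    _ = _ := mul_comm _ _

/-- Each term changes by `(f - g) * (2 * f₀ - f - g)`, whose second factor is at most 2 in absolute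
value. -/
theorem sqDist_le_add_of_abs_le {f g : Pref X K} {α : ℝ}
    (hfg : ∀ z, |(f z : ℝ) - (g z : ℝ)| ≤ α) (f₀ : Pref X K) (h : List Bool) :
    sqDist query g f₀ h ≤ sqDist query f f₀ h + 2 * α * h.length := by
  induction h with
  | nil => simp [sqDist]
  | cons y h ih =>
    simp only [sqDist, List.length_cons]
    push_cast
    set z := query h
    have hb : |2 * (f₀ z : ℝ) - f z - g z| ≤ 2 := by
      rw [abs_le]
      constructor <;> linarith [(f z).2.1, (f z).2.2, (g z).2.1, (g z).2.2, (f₀ z).2.1, (f₀ z).2.2]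
    have := mul_le_two_mul_of_abs_le (hfg z) hb
    nlinarith

theorem loss_le_add_of_abs_le {f g : Pref X K} {α : ℝ}
    (hfg : ∀ z, |(f z : ℝ) - (g z : ℝ)| ≤ α) (h : List Bool) :
    loss query g h ≤ loss query f h + 2 * α * h.length := by
  induction h with
  | nil => simp [loss]
  | cons y h ih =>
    simp only [loss, List.length_cons]
    push_cast
    set z := query h
    have hy : 0 ≤ label y ∧ label y ≤ 1 := by cases y <;> simp [label]
    have hb : |2 * label y - f z - g z| ≤ 2 := by
      rw [abs_le]
      constructor <;> linarith [(f z).2.1, (f z).2.2, (g z).2.1, (g z).2.2, hy.1, hy.2]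
    have := mul_le_two_mul_of_abs_le (hfg z) hb
    nlinarith

theorem two_mul_log_add_six_le_confRadius {t : ℕ} (ht : 1 ≤ t) (hδ : 0 < δ) (hδ1 : δ ≤ 1)
    (hN : 1 ≤ (coveringNumber F (1 / (t : ℝ))).toNat) :
    2 * Real.log ((coveringNumber F (1 / (t : ℝ))).toNat / δ) + 6 ≤ confRadius F δ t := by
  have hN' : (1 : ℝ) ≤ (coveringNumber F (1 / (t : ℝ))).toNat := by exact_mod_cast hN
  have ht' : (1 : ℝ) ≤ t := by exact_mod_cast ht
  have h1 : Real.log ((coveringNumber F (1 / (t : ℝ))).toNat / δ) ≤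
      Real.log (2 * (coveringNumber F (1 / (t : ℝ))).toNat / δ) := by
    apply Real.log_le_log (by positivity)
    gcongr
    linarith
  have h2 : 1 ≤ Real.sqrt (Real.log (4 * (t : ℝ) * ((t : ℝ) + 1) / δ)) := by
    rw [Real.one_le_sqrt, Real.le_log_iff_exp_le (by positivity), le_div_iff₀ hδ]
    nlinarith [Real.exp_one_lt_d9, Real.exp_pos 1]
  unfold confRadius
  linarith

/-- The estimate depends on the labels, so the deviation bound is applied to a nearby cover element
`g`. At scale `1 / t` the exchange costs at most 2 in `sqDist` and 2 in `loss`; the latter counts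
twice because `excess` contains half of `sqDist`. Hence the slack 6 in the radius. -/
theorem mem_confSet_of_excess_le {fstar : Pref X K} (hfstar : fstar ∈ F) (hδ : 0 < δ) (hδ1 : δ ≤ 1)
    {h : List Bool} (hest : est h ∈ F) (hmin : loss query (est h) h ≤ loss query fstar h)
    {G : Finset (Pref X K)} (hG : IsCover F (1 / ((h.length + 1 : ℕ) : ℝ)) G)
    (hcard : G.card = (coveringNumber F (1 / ((h.length + 1 : ℕ) : ℝ))).toNat)
    (hexc : ∀ g ∈ G, excess fstar query g h ≤ Real.log (G.card / δ)) :
    fstar ∈ confSet F δ est query h := by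
  refine ⟨hfstar, ?_⟩
  obtain ⟨g, hg, hfg⟩ := hG.2 _ hest
  have hgf : ∀ z, |(g z : ℝ) - (est h z : ℝ)| ≤ 1 / ((h.length + 1 : ℕ) : ℝ) := fun z => by
    rw [abs_sub_comm]; exact hfg z
  have h1 := sqDist_le_add_of_abs_le (query := query) hgf fstar h
  have h2 := loss_le_add_of_abs_le (query := query) hfg h
  have h3 := hexc g hg
  have hn : 2 * (1 / ((h.length + 1 : ℕ) : ℝ)) * h.length ≤ 2 := by
    push_cast
    rw [mul_assoc, one_div, inv_mul_eq_div]
    have : (h.length : ℝ) / (h.length + 1) ≤ 1 := by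
      rw [div_le_one (by positivity)]; linarith
    linarith
  have hR := two_mul_log_add_six_le_confRadius (F := F) (t := h.length + 1) (by omega) hδ hδ1
    (hcard ▸ Finset.card_pos.2 ⟨g, hg⟩)
  rw [← hcard] at hR
  rw [sqDist_comm]
  unfold excess at h3
  linarith

theorem est_mem_confSet {f : Pref X K} {h : List Bool} (hest : est h ∈ F)
    (hf : f ∈ confSet F δ est query h) : est h ∈ confSet F δ est query h :=
  ⟨hest, by rw [sqDist_self]; exact (sqDist_nonneg f (est h) h).trans hf.2⟩

theorem abs_sub_le_bonus {f₁ f₂ : Pref X K} {h : List Bool}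
    (h₁ : f₁ ∈ confSet F δ est query h) (h₂ : f₂ ∈ confSet F δ est query h) (q : Query X K) :
    |(f₁ q : ℝ) - (f₂ q : ℝ)| ≤ bonus F δ est query h q := by
  refine le_csSup ⟨1, ?_⟩ ⟨f₁, h₁, f₂, h₂, rfl⟩
  rintro r ⟨g₁, -, g₂, -, rfl⟩
  rw [abs_le]
  constructor <;> linarith [(g₁ q).2.1, (g₁ q).2.2, (g₂ q).2.1, (g₂ q).2.2]

/-- Swapping the pair removes the absolute value, as eluder sequences use signed differences. -/
theorem exists_lt_sub_of_lt_bonus {ε : ℝ} {f : Pref X K} {h : List Bool}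
    (hf : f ∈ confSet F δ est query h) {q : Query X K} (hε : ε < bonus F δ est query h q) :
    ∃ f₁ ∈ confSet F δ est query h, ∃ f₂ ∈ confSet F δ est query h,
      ε < (f₁ q : ℝ) - (f₂ q : ℝ) := by
  obtain ⟨_, ⟨f₁, h₁, f₂, h₂, rfl⟩, hlt⟩ := exists_lt_of_lt_csSup
    (by exact ⟨_, f, hf, f, hf, rfl⟩) hε
  rcases lt_abs.1 hlt with hlt | hlt
  · exact ⟨f₁, h₁, f₂, h₂, hlt⟩
  · exact ⟨f₂, h₂, f₁, h₁, by linarith⟩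

end Confidence

/-! ### Soundness of elimination and control of the gap. -/

section Elimination

variable {X : Type*} {K : ℕ} {F : Set (Pref X K)} {δ : ℝ} {est : List Bool → Pref X K}
  {query : List Bool → Query X K} {fstar : Pref X K} {astar : X → Fin K}

/-- The winner of `x` is still present, and it is the only action left once `x` has been dropped. -/
def State.Sound (S : State X K) (astar : X → Fin K) : Prop :=
  ∀ x, astar x ∈ S.actions x ∧ (x ∉ S.contexts → S.actions x = {astar x})

theorem State.sound_univ : (⟨Set.univ, fun _ => Set.univ⟩ : State X K).Sound astar := fun _ =>
  ⟨trivial, fun hx => absurd trivial hx⟩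

/-- The winner passes every test because `est h` falls below `fstar` by at most one bonus. A context
dropped with one action left is therefore left with its winner. -/
theorem State.Sound.step {S : State X K} (hS : S.Sound astar)
    (hwin : ∀ x a, 1 / 2 ≤ (fstar (x, astar x, a) : ℝ)) {h : List Bool} (hest : est h ∈ F)
    (hf : fstar ∈ confSet F δ est query h) : (step F δ est query h S).Sound astar := by
  intro x
  have hmem : astar x ∈ eliminate F δ est query h S x := by
    refine ⟨(hS x).1, fun _ a₀ _ => ?_⟩
    have h1 := abs_sub_le_bonus hf (est_mem_confSet hest hf) (x, astar x, a₀)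
    linarith [hwin x a₀, le_abs_self ((fstar (x, astar x, a₀) : ℝ) - est h (x, astar x, a₀))]
  refine ⟨hmem, fun hx => ?_⟩
  change eliminate F δ est query h S x = {astar x}
  by_cases hxS : x ∈ S.contexts
  · have hcard : (eliminate F δ est query h S x).ncard = 1 := by
      by_contra hne
      exact hx ⟨hxS, hne⟩
    obtain ⟨a, ha⟩ := Set.ncard_eq_one.1 hcard
    rw [ha] at hmem ⊢
    rw [Set.mem_singleton_iff.1 hmem]
  · rw [← (hS x).2 hxS]
    ext a
    exact ⟨fun ha => ha.1, fun ha => ⟨ha, fun h => absurd h hxS⟩⟩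

theorem sound_state (hwin : ∀ x a, 1 / 2 ≤ (fstar (x, astar x, a) : ℝ)) {h : List Bool}
    (hest : ∀ h', h' <:+ h → est h' ∈ F)
    (hf : ∀ h', h' <:+ h → fstar ∈ confSet F δ est query h') :
    (state F δ est query h).Sound astar := by
  induction h with
  | nil =>
    exact State.Sound.step State.sound_univ hwin
      (hest _ List.suffix_rfl) (hf _ List.suffix_rfl)
  | cons y h ih =>
    exact (ih (fun h' hs => hest h' (hs.trans (List.suffix_cons y h)))
      (fun h' hs => hf h' (hs.trans (List.suffix_cons y h)))).step hwin
      (hest _ List.suffix_rfl) (hf _ List.suffix_rfl)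

/-- This makes a late survivor a candidate in every earlier round. -/
theorem state_mono {h h' : List Bool} (hs : h' <:+ h) {x : X}
    (hx : x ∈ (state F δ est query h).contexts) :
    x ∈ (state F δ est query h').contexts ∧
      (state F δ est query h).actions x ⊆ (state F δ est query h').actions x := by
  induction h with
  | nil =>
    obtain rfl := List.suffix_nil.1 hs
    exact ⟨hx, subset_rfl⟩
  | cons y h ih =>
    rcases List.suffix_cons_iff.1 hs with rfl | hs
    · exact ⟨hx, subset_rfl⟩
    · have := ih hs hx.1
      exact ⟨this.1, fun a ha => this.2 ha.1⟩

/-- Passing the test against the winner costs one bonus, and replacing the estimate by `fstar` costs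
a second. -/
theorem sub_half_le_of_mem_step (hsymm : ∀ x a a', (fstar (x, a, a') : ℝ) + fstar (x, a', a) = 1)
    {S : State X K} (hS : S.Sound astar) {h : List Bool} (hest : est h ∈ F)
    (hf : fstar ∈ confSet F δ est query h) {x : X} (hx : x ∈ S.contexts) {a : Fin K}
    (ha : a ∈ (step F δ est query h S).actions x) :
    (fstar (x, astar x, a) : ℝ) - 1 / 2 ≤ 2 * bonus F δ est query h (x, a, astar x) := by
  have h1 := ha.2 hx (astar x) (hS x).1
  have h2 := abs_sub_le_bonus hf (est_mem_confSet hest hf) (x, a, astar x)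
  linarith [hsymm x a (astar x),
    neg_abs_le ((fstar (x, a, astar x) : ℝ) - est h (x, a, astar x))]

theorem sub_half_le_of_mem_state (hwin : ∀ x a, 1 / 2 ≤ (fstar (x, astar x, a) : ℝ))
    (hsymm : ∀ x a a', (fstar (x, a, a') : ℝ) + fstar (x, a', a) = 1) {h : List Bool}
    (hest : ∀ h', h' <:+ h → est h' ∈ F)
    (hf : ∀ h', h' <:+ h → fstar ∈ confSet F δ est query h')
    {x : X} (hx : x ∈ (state F δ est query h).contexts) {a : Fin K}
    (ha : a ∈ (state F δ est query h).actions x) :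
    (fstar (x, astar x, a) : ℝ) - 1 / 2 ≤ 2 * bonus F δ est query h (x, a, astar x) := by
  cases h with
  | nil =>
    exact sub_half_le_of_mem_step hsymm State.sound_univ (hest _ List.suffix_rfl)
      (hf _ List.suffix_rfl) trivial ha
  | cons y h =>
    exact sub_half_le_of_mem_step hsymm
      (sound_state hwin (fun h' hs => hest h' (hs.trans (List.suffix_cons y h)))
        (fun h' hs => hf h' (hs.trans (List.suffix_cons y h))))
      (hest _ List.suffix_rfl) (hf _ List.suffix_rfl) hx.1 ha

/-- The gap of a surviving action in a context still under consideration is controlled by the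
maximal bonus of every round so far. -/
theorem sub_half_le_bonus_query {T : ℕ} (hex : IsExecution F δ T est query)
    (hwin : ∀ x a, 1 / 2 ≤ (fstar (x, astar x, a) : ℝ))
    (hsymm : ∀ x a a', (fstar (x, a, a') : ℝ) + fstar (x, a', a) = 1) {h : List Bool}
    (hT : h.length < T) (hf : ∀ h', h' <:+ h → fstar ∈ confSet F δ est query h')
    {x : X} (hx : x ∈ (state F δ est query h).contexts) {a : Fin K}
    (ha : a ∈ (state F δ est query h).actions x) {h' : List Bool} (hs : h' <:+ h) :
    (fstar (x, astar x, a) : ℝ) - 1 / 2 ≤ 2 * bonus F δ est query h' (query h') := by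
  have hlen : ∀ l, l <:+ h → l.length < T := fun l hl => hl.length_le.trans_lt hT
  have hest : ∀ l, l <:+ h' → est l ∈ F := fun l hl => hex.est_mem l (hlen l (hl.trans hs))
  have hf' : ∀ l, l <:+ h' → fstar ∈ confSet F δ est query l := fun l hl => hf l (hl.trans hs)
  obtain ⟨hx', hsub⟩ := state_mono hs hx
  have h1 := sub_half_le_of_mem_state hwin hsymm hest hf' hx' (hsub ha)
  have h2 := hex.query_max h' (hlen h' hs) (x, a, astar x)
    ⟨hx', hsub ha, (sound_state hwin hest hf' x).1⟩
  linarith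

end Elimination

/-! ### Chronological indexing of histories. -/

section Histories

variable {X : Type*} {K : ℕ} {query : List Bool → Query X K}

/-- Labels are stored newest first, so `h.drop (h.length - j)` is the history of length `j`, that of
round `j + 1`. -/
theorem sqDist_drop (f g : Pref X K) (h : List Bool) {n : ℕ} (hn : n ≤ h.length) :
    sqDist query f g (h.drop (h.length - n)) = ∑ j ∈ Finset.range n,
      ((f (query (h.drop (h.length - j))) : ℝ) - g (query (h.drop (h.length - j)))) ^ 2 := by
  induction n with
  | zero => simp [sqDist]
  | succ n ih =>
    rw [Finset.sum_range_succ, ← ih (by omega),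
      List.drop_eq_getElem_cons (by omega : h.length - (n + 1) < h.length),
      show h.length - (n + 1) + 1 = h.length - n by omega]
    rfl

end Histories
end APOGen

/-! ### From bonuses to the rate. -/

namespace APOGen

section Gap

variable {X : Type*} {K : ℕ} {F : Set (Pref X K)} {est : List Bool → Pref X K}
  {query : List Bool → Query X K} {fstar : Pref X K} {astar : X → Fin K}

theorem half_lt_log {N T δ : ℝ} (hN : 1 ≤ N) (hT : 2 ≤ T) (hδ : 0 < δ) (hδ1 : δ < 1) :
    1 / 2 < Real.log (N * T / δ) := by
  have h2 : 2 ≤ N * T / δ := by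
    rw [le_div_iff₀ hδ]
    nlinarith
  have := Real.log_le_log (by norm_num) h2
  linarith [Real.log_two_gt_d9]

theorem confRadius_le {T : ℕ} (hT : 2 ≤ T) {δ : ℝ} (hδ : 0 < δ) (hδ1 : δ < 1)
    (hF : F.Nonempty) (hcov : coveringNumber F (1 / (T : ℝ)) ≠ ⊤) {t : ℕ} (ht : 1 ≤ t)
    (htT : t ≤ T) :
    confRadius F (δ / T) t ≤
      20 * Real.log (((coveringNumber F (1 / (T : ℝ))).toNat : ℝ) * T / δ) := by
  have ht0 : (1 : ℝ) ≤ t := by exact_mod_cast ht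
  have htT' : (t : ℝ) ≤ T := by exact_mod_cast htT
  have hT' : (2 : ℝ) ≤ T := by exact_mod_cast hT
  have hle : coveringNumber F (1 / (t : ℝ)) ≤ coveringNumber F (1 / (T : ℝ)) :=
    coveringNumber_antitone (one_div_le_one_div_of_le (by linarith) htT')
  have hcov' : coveringNumber F (1 / (t : ℝ)) ≠ ⊤ := (hle.trans_lt hcov.lt_top).ne
  have hn1 : (1 : ℝ) ≤ (coveringNumber F (1 / (t : ℝ))).toNat := by
    exact_mod_cast one_le_toNat_coveringNumber hF hcov'
  have hnN : ((coveringNumber F (1 / (t : ℝ))).toNat : ℝ) ≤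
      (coveringNumber F (1 / (T : ℝ))).toNat := by
    exact_mod_cast ENat.toNat_le_toNat hle hcov
  unfold confRadius
  set n := ((coveringNumber F (1 / (t : ℝ))).toNat : ℝ)
  set N := ((coveringNumber F (1 / (T : ℝ))).toNat : ℝ)
  have hL := half_lt_log (hn1.trans hnN) hT' hδ hδ1
  set L := Real.log (N * T / δ) with hLdef
  have hN0 : 0 < N := by linarith
  have hq0 : 0 < N * T / δ := by positivity
  have hTq : T / δ ≤ N * T / δ := by
    gcongr
    nlinarith
  have hq2 : 2 ≤ N * T / δ := le_trans (by rw [le_div_iff₀ hδ]; nlinarith) hTq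
  have h1 : Real.log (2 * n / (δ / T)) ≤ 2 * L := by
    have : 2 * L = Real.log ((N * T / δ) ^ 2) := by rw [Real.log_pow]; push_cast; ring
    rw [this]
    apply Real.log_le_log (by positivity)
    calc 2 * n / (δ / T) = 2 * (n * T / δ) := by field_simp
      _ ≤ 2 * (N * T / δ) := by gcongr
      _ ≤ _ := by nlinarith
  have h2 : Real.log (4 * t * (t + 1) / (δ / T)) ≤ 6 * L := by
    have : 6 * L = Real.log ((N * T / δ) ^ 6) := by rw [Real.log_pow]; push_cast; ring
    rw [this]
    apply Real.log_le_log (by positivity)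
    have hT0 : (T : ℝ) ≤ T / δ := by
      rw [le_div_iff₀ hδ]; nlinarith
    have htq : (t : ℝ) ≤ N * T / δ := htT'.trans (hT0.trans hTq)
    have htq' : (t : ℝ) + 1 ≤ 2 * (N * T / δ) := by linarith
    calc 4 * t * (t + 1) / (δ / T) = 4 * t * (t + 1) * (T / δ) := by field_simp
      -- With `q = N * T / δ`, each of `t`, `(t + 1) / 2` and `T / δ` is at most `q`; the constant
      -- `2 ^ 3` is then absorbed using `2 ≤ q`.
      _ ≤ 4 * (N * T / δ) * (2 * (N * T / δ)) * (N * T / δ) := by gcongr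
      _ = 2 ^ 3 * (N * T / δ) ^ 3 := by ring
      _ ≤ (N * T / δ) ^ 3 * (N * T / δ) ^ 3 := by gcongr
      _ = _ := by ring
  have h3 : 2 * Real.sqrt (Real.log (4 * t * (t + 1) / (δ / T))) ≤ 6 * L + 1 := by
    have h4 := Real.sqrt_le_sqrt h2
    have h5 := Real.sq_sqrt (show 0 ≤ 6 * L by linarith)
    nlinarith [sq_nonneg (Real.sqrt (6 * L) - 1)]
  -- The total is at most `4 * L + (6 * L + 1) + 4`, and `L > 1 / 2` absorbs the constant 5.
  linarith

/-- If all bonuses of `T` rounds exceed `ε`, then `T` is at most of order `β * d / ε ^ 2`. -/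
theorem le_mul_eluderDim_of_lt_bonus {T : ℕ} {δ ε β : ℝ} (hε : 0 < ε)
    (hεT : 1 / (T : ℝ) ≤ ε) (hd : eluderDim F (1 / (T : ℝ)) ≠ ⊤)
    (hβ : ∀ t, 1 ≤ t → t ≤ T → confRadius F δ t ≤ β) (hβ0 : 0 ≤ β)
    {h : List Bool} (hT' : h.length + 1 = T)
    (hf : ∀ h', h' <:+ h → fstar ∈ confSet F δ est query h')
    (hb : ∀ h', h' <:+ h → ε < bonus F δ est query h' (query h')) :
    (T : ℝ) ≤ (4 * β / ε ^ 2 + 1) * (eluderDim F (1 / (T : ℝ))).toNat := by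
  have hk := Nat.lt_floor_add_one (4 * β / ε ^ 2)
  have hk' := Nat.floor_le (show 0 ≤ 4 * β / ε ^ 2 by positivity)
  -- Chosen so that `4 * β ≤ k * ε ^ 2`, where `4 * β` bounds the squared distance of two members of
  -- a confidence set.
  set k := ⌊4 * β / ε ^ 2⌋₊ + 1 with hkdef
  have hcard := card_le_mul_eluderDim (F := F) hε.le hεT
    (fun i => query (h.drop (h.length - i))) (k := k) (by omega) (Finset.range T) hd (by
      intro i hi
      have hiT : i < T := Finset.mem_range.1 hi
      have hs : h.drop (h.length - i) <:+ h := List.drop_suffix _ _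
      obtain ⟨f₁, h₁, f₂, h₂, hlt⟩ := exists_lt_sub_of_lt_bonus (hf _ hs) (hb _ hs)
      refine ⟨f₁, h₁.1, f₂, h₂.1, ?_, hlt⟩
      have hfil : (Finset.range T).filter (· < i) = Finset.range i := by
        ext j; simp; omega
      rw [hfil, ← sqDist_drop f₁ f₂ h (by omega)]
      have hlen : (h.drop (h.length - i)).length = i := by simp; omega
      have hR := hβ (i + 1) (by omega) (by omega)
      have e1 := h₁.2
      have e2 := h₂.2
      rw [hlen] at e1 e2
      have e3 := sqDist_le_two_mul_add (query := query) f₁ f₂ (est (h.drop (h.length - i)))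
        (h.drop (h.length - i))
      have hkε : 4 * β ≤ k * ε ^ 2 := by
        rw [div_lt_iff₀ (by positivity)] at hk
        push_cast [hkdef]
        exact hk.le
      linarith)
  rw [Finset.card_range] at hcard
  have hcard' : (T : ℝ) ≤ k * (eluderDim F (1 / (T : ℝ))).toNat := by exact_mod_cast hcard
  refine hcard'.trans ?_
  gcongr
  push_cast [hkdef]
  linarith

theorem sub_half_le_of_mem_final [Nonempty X] {T : ℕ} (hT : 2 ≤ T) {δ : ℝ} (hδ : 0 < δ)
    (hδ1 : δ < 1) (hfstar : fstar ∈ F)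
    (hcov : coveringNumber F (1 / (T : ℝ)) ≠ ⊤) (hd : eluderDim F (1 / (T : ℝ)) ≠ ⊤)
    (hex : IsExecution F (δ / T) T est query)
    (hwin : ∀ x a, 1 / 2 ≤ (fstar (x, astar x, a) : ℝ))
    (hsymm : ∀ x a a', (fstar (x, a, a') : ℝ) + fstar (x, a', a) = 1) {h : List Bool}
    (hlen : h.length + 1 = T) (hf : ∀ h', h' <:+ h → fstar ∈ confSet F (δ / T) est query h')
    {x : X} {a : Fin K} (ha : a ∈ (state F (δ / T) est query h).actions x) :
    (fstar (x, astar x, a) : ℝ) - 1 / 2 ≤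
      51 * Real.sqrt (Real.log (((coveringNumber F (1 / (T : ℝ))).toNat : ℝ) * T / δ)
        * ((eluderDim F (1 / (T : ℝ))).toNat : ℝ) / T) := by
  have hT' : (2 : ℝ) ≤ T := by exact_mod_cast hT
  have hN : (1 : ℝ) ≤ (coveringNumber F (1 / (T : ℝ))).toNat := by
    exact_mod_cast one_le_toNat_coveringNumber ⟨fstar, hfstar⟩ hcov
  have : Nonempty (Query X K) := ⟨(x, a, a)⟩
  have hd1 : (1 : ℝ) ≤ (eluderDim F (1 / (T : ℝ))).toNat := by
    have := ENat.toNat_le_toNat (one_le_eluderDim (F := F) (1 / (T : ℝ))) hd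
    exact_mod_cast this
  have hL := half_lt_log hN hT' hδ hδ1
  have hβ := fun t (ht : 1 ≤ t) (htT : t ≤ T) =>
    confRadius_le hT hδ hδ1 ⟨fstar, hfstar⟩ hcov ht htT
  have hest : ∀ l, l <:+ h → est l ∈ F := fun l hl =>
    hex.est_mem l (by have := hl.length_le; omega)
  have hsound := sound_state hwin hest hf x
  by_cases hx : x ∈ (state F (δ / T) est query h).contexts
  swap
  · have hax : a = astar x := by
      rw [hsound.2 hx] at ha
      exact ha
    rw [hax]
    have := hsymm x (astar x) (astar x)
    have h0 : (fstar (x, astar x, astar x) : ℝ) - 1 / 2 = 0 := by linarith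
    rw [h0]
    positivity
  have hgap := fun h' hs => sub_half_le_bonus_query hex hwin hsymm (h := h) (by omega) hf hx ha
    (h' := h') hs
  have hg1 : (fstar (x, astar x, a) : ℝ) - 1 / 2 ≤ 1 / 2 := by
    linarith [(fstar (x, astar x, a)).2.2]
  have helu := fun ε hε hεT => le_mul_eluderDim_of_lt_bonus (fstar := fstar) (est := est)
    (query := query) (T := T) (ε := ε) hε hεT hd hβ (by linarith) hlen hf
  set g : ℝ := (fstar (x, astar x, a) : ℝ) - 1 / 2
  set L := Real.log (((coveringNumber F (1 / (T : ℝ))).toNat : ℝ) * T / δ)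
  set d := ((eluderDim F (1 / (T : ℝ))).toNat : ℝ)
  have hg0 : 0 ≤ g := sub_nonneg.2 (hwin x a)
  -- `2560 = 2 * 4 * 20 * 4 ^ 2` comes from `β = 20 * L`, `ε = g / 4` and `T ≥ 2 * d`, and `2560 ≤
  -- 51 ^ 2`. The cases `g / 4 < 1 / T` and `T < 2 * d` need only `g ≤ 1 / 2` and `L * d ≥ 1 / 2`,
  -- or `L > 1 / 2`.
  suffices hsq : g ^ 2 * T ≤ 2560 * (L * d) by
    have h1 : g ^ 2 ≤ 51 ^ 2 * (L * d / T) := by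
      rw [← mul_div_assoc, le_div_iff₀ (by linarith)]
      nlinarith [mul_nonneg (show 0 ≤ L by linarith) (show 0 ≤ d by linarith)]
    calc g = Real.sqrt (g ^ 2) := (Real.sqrt_sq hg0).symm
      _ ≤ Real.sqrt (51 ^ 2 * (L * d / T)) := Real.sqrt_le_sqrt h1
      _ = _ := by rw [Real.sqrt_mul (by norm_num), Real.sqrt_sq (by norm_num)]
  have hLd : 1 / 2 ≤ L * d := by nlinarith
  by_cases hgT : g / 4 < 1 / T
  · have h1 : g * T ≤ 4 := by
      rw [lt_div_iff₀ (by linarith)] at hgT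
      linarith
    nlinarith
  by_cases hdT : (T : ℝ) < 2 * d
  · have h1 : g ^ 2 ≤ 1 / 4 := by nlinarith
    have h2 : g ^ 2 * T ≤ 1 / 4 * (2 * d) := by gcongr
    nlinarith
  push Not at hgT hdT
  have hgpos : 0 < g := by
    have : (0 : ℝ) < 1 / T := by positivity
    linarith
  -- Every queried bonus is at least `g / 2`; the level `g / 4` gives the strict inequality since `g
  -- > 0`.
  have h1 := helu (g / 4) (by linarith) hgT fun h' hs => by linarith [hgap h' hs]
  have h2 : (T : ℝ) / 2 ≤ 4 * (20 * L) / (g / 4) ^ 2 * d := by linarith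
  have h3 : 4 * (20 * L) / (g / 4) ^ 2 * d = 1280 * (L * d) / g ^ 2 := by
    field_simp
    ring
  rw [h3, le_div_iff₀ (by positivity)] at h2
  linarith

end Gap

theorem toOuterMeasure_notMem_confSet_le {X : Type*} {K : ℕ} {F : Set (Pref X K)}
    {est : List Bool → Pref X K} {query : List Bool → Query X K} {fstar : Pref X K} {T : ℕ}
    {δ : ℝ} (hδ : 0 < δ) (hδ1 : δ ≤ 1) (hfstar : fstar ∈ F)
    (hcov : coveringNumber F (1 / (T : ℝ)) ≠ ⊤) (hex : IsExecution F δ T est query) {n : ℕ}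
    (hn : n < T) :
    (interaction fstar query n).toOuterMeasure {h | ¬ fstar ∈ confSet F δ est query h} ≤
      ENNReal.ofReal δ := by
  have hle : coveringNumber F (1 / ((n + 1 : ℕ) : ℝ)) ≤ coveringNumber F (1 / (T : ℝ)) :=
    coveringNumber_antitone
      (one_div_le_one_div_of_le (by positivity) (by exact_mod_cast Nat.succ_le_of_lt hn))
  obtain ⟨G, hG, hcard⟩ := exists_isCover_card_eq (hle.trans_lt hcov.lt_top).ne
  refine (PMF.toOuterMeasure_mono _ ?_).trans
    (toOuterMeasure_exists_lt_excess_le fstar query G n hδ)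
  rintro h ⟨hh, hs⟩
  obtain rfl := length_of_mem_support_interaction fstar query hs
  by_contra hcon
  simp only [Set.mem_ofPred_eq, not_exists, not_and, not_lt] at hcon
  exact hh (mem_confSet_of_excess_le hfstar hδ hδ1 (hex.est_mem h hn)
    (hex.est_le h hn fstar hfstar) hG hcard hcon)

end APOGen

/-! ### The main theorem. -/

theorem theorem4 :
    ∃ C : ℝ, 0 < C ∧
      ∀ (X : Type*) [Nonempty X] (K : ℕ) (F : Set (APOGen.Pref X K)),
        (∀ f ∈ F, ∀ x a a', (f (x, a, a') : ℝ) + (f (x, a', a) : ℝ) = 1) →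
      ∀ fstar ∈ F, ∀ astar : X → Fin K,
        (∀ x a, 1 / 2 ≤ (fstar (x, astar x, a) : ℝ)) →
      ∀ T : ℕ, 2 ≤ T → ∀ δ : ℝ, 0 < δ → δ < 1 →
        APOGen.coveringNumber F (1 / (T : ℝ)) ≠ ⊤ →
        APOGen.eluderDim F (1 / (T : ℝ)) ≠ ⊤ →
      ∀ (est : List Bool → APOGen.Pref X K) (query : List Bool → APOGen.Query X K),
        APOGen.IsExecution F (δ / T) T est query →
        ENNReal.ofReal (1 - δ) ≤ (APOGen.interaction fstar query T).toOuterMeasure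
          {ys | (∀ x, (APOGen.finalActions F (δ / T) est query ys x).Nonempty) ∧
            ∀ pol : X → Fin K,
              (∀ x, pol x ∈ APOGen.finalActions F (δ / T) est query ys x) →
              APOGen.subOptGap fstar astar pol ≤
                C * Real.sqrt (Real.log
                    (((APOGen.coveringNumber F (1 / (T : ℝ))).toNat : ℝ) * T / δ)
                  * ((APOGen.eluderDim F (1 / (T : ℝ))).toNat : ℝ) / T)} := by
  refine ⟨51, by norm_num, ?_⟩
  intro X _ K F hsymm fstar hfstar astar hwin T hT δ hδ hδ1 hcov hd est query hex
  set A := {ys : List Bool | (∀ x, (APOGen.finalActions F (δ / T) est query ys x).Nonempty) ∧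
    ∀ pol : X → Fin K, (∀ x, pol x ∈ APOGen.finalActions F (δ / T) est query ys x) →
      APOGen.subOptGap fstar astar pol ≤ 51 * Real.sqrt (Real.log
        (((APOGen.coveringNumber F (1 / (T : ℝ))).toNat : ℝ) * T / δ)
          * ((APOGen.eluderDim F (1 / (T : ℝ))).toNat : ℝ) / T)} with hA
  -- The output depends only on the first `T - 1` labels, so the bad event is stated for histories
  -- of length `n`; such a history has `n + 1` suffixes, one per round.
  obtain ⟨n, rfl⟩ : ∃ n, T = n + 1 := ⟨T - 1, by omega⟩
  have hT' : (2 : ℝ) ≤ ((n + 1 : ℕ) : ℝ) := by exact_mod_cast hT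
  have hδT : 0 < δ / ((n + 1 : ℕ) : ℝ) := by positivity
  have hδT1 : δ / ((n + 1 : ℕ) : ℝ) ≤ 1 := by
    rw [div_le_one (by linarith)]; linarith
  set bad := {h : List Bool | ¬ ∀ h', h' <:+ h →
    fstar ∈ APOGen.confSet F (δ / (n + 1 : ℕ)) est query h'} with hbad
  have hbad_le : (APOGen.interaction fstar query n).toOuterMeasure bad ≤ ENNReal.ofReal δ := by
    refine (APOGen.toOuterMeasure_exists_suffix_le fstar query (T := n + 1)
      (fun m hm => APOGen.toOuterMeasure_notMem_confSet_le hδT hδT1 hfstar hcov hex hm) n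
      (Nat.lt_succ_self n)).trans (le_of_eq ?_)
    rw [← ENNReal.ofReal_natCast, ← ENNReal.ofReal_mul (by positivity)]
    congr 1
    field_simp
  have hcompl : (APOGen.interaction fstar query (n + 1)).toOuterMeasure Aᶜ ≤
      ENNReal.ofReal δ := by
    refine le_trans (PMF.toOuterMeasure_mono _ ?_)
      ((APOGen.toOuterMeasure_interaction_succ_tail fstar query n bad).trans_le hbad_le)
    rintro ys ⟨hys, hs⟩
    have hlen := APOGen.length_of_mem_support_interaction fstar query hs
    have hlen' : ys.tail.length + 1 = n + 1 := by rw [List.length_tail]; omega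
    intro hf
    refine hys ⟨fun x => ⟨astar x, (APOGen.sound_state hwin (fun h' hs' =>
      hex.est_mem h' (by have := hs'.length_le; omega)) hf x).1⟩, fun pol hpol =>
        ciSup_le fun x => ?_⟩
    exact APOGen.sub_half_le_of_mem_final hT hδ hδ1 hfstar hcov hd hex hwin
      (hsymm fstar hfstar) hlen' hf (hpol x)
  -- Subadditivity of the outer measure suffices to pass to the complement, so no measurability is
  -- needed.
  have hone : 1 ≤ (APOGen.interaction fstar query (n + 1)).toOuterMeasure A +
      (APOGen.interaction fstar query (n + 1)).toOuterMeasure Aᶜ := by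
    rw [← (PMF.toOuterMeasure_apply_eq_one_iff (APOGen.interaction fstar query (n + 1)) _).2
      (Set.subset_univ _), ← Set.union_compl_self A]
    exact MeasureTheory.measure_union_le _ _
  rw [ENNReal.ofReal_sub _ hδ.le, ENNReal.ofReal_one]
  exact tsub_le_iff_right.2 (hone.trans (by gcongr))
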